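/- (No crossing on a ring.) Let $n\in\mathbb{N}$, let $R_n$ be the cycle graph with vertices $1,\dots,n$ and edges $\{1,2\},\{2,3\},\dots,\{n-1,n\},\{n,1\}$, and let $|R_n\rangle=\prod_{\{i,j\}\in E(R_n)}CZ_{i,j}\,|+\rangle^{\otimes n}$ be the corresponding $n$-qubit graph state. Let $a_1,b_1,a_2,b_2\in\{1,\dots,n\}$ with $a_1=1<b_1<a_2<b_2$. Then: (i) No finite protocol that starts from $|R_n\rangle$ and consists of single-qubit Clifford unitaries and single-qubit Pauli measurements, where every operation may depend on all earlier measurement outcomes (classical communication), produces with nonzero probability a state of the form $|\phi\rangle_{a_1a_2}\otimes|\phi'\rangle_{b_1b_2}\otimes|\chi\rangle_{\mathrm{rest}}$ in which $|\phi\rangle$ and $|\phi'\rangle$ are maximally entangled two-qubit states. (ii) The graph $K_2\cup K_2=(\{a_1,a_2,b_1,b_2\},\{\{a_1,a_2\},\{b_1,b_2\}\})$ is not a vertex-minor of $R_n$, i.e. it cannot be obtained from $R_n$ (with vertex labels kept) by a sequence of local complementations and vertex deletions. Here the local complementation of a graph at a vertex $v$ exchanges edges and non-edges between distinct neighbours of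 $v$. -/

import Mathlib

open scoped Matrix

/-! ### Labelled graphs and vertex-minors -/

/-- A simple graph whose vertex set is a subset of the label set `V`. -/
abbrev LabelledGraph (V : Type*) := (⊤ : SimpleGraph V).Subgraph

namespace LabelledGraph

/-- Local complementation at `v`: an edge between two distinct neighbours of `v` is removed if it
is present and added if it is absent; all other pairs are left unchanged. -/
def localComplement {V : Type*} (G : LabelledGraph V) (v : V) : LabelledGraph V where
  verts := G.verts
  Adj x y := Xor (G.Adj x y) (x ≠ y ∧ G.Adj v x ∧ G.Adj v y)
  adj_sub := by
    rintro x y (⟨h, -⟩ | ⟨⟨h, -⟩, -⟩)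
    · exact G.adj_sub h
    · exact h
  edge_vert := by
    rintro x y (⟨h, -⟩ | ⟨⟨-, h, -⟩, -⟩)
    · exact G.edge_vert h
    · exact G.edge_vert h.symm
  symm := by
    constructor
    intro x y h
    have e : G.Adj y x ↔ G.Adj x y := G.adj_comm y x
    have e' : (y ≠ x) ↔ (x ≠ y) := ne_comm
    have e'' : (G.Adj v y ∧ G.Adj v x) ↔ (G.Adj v x ∧ G.Adj v y) := and_comm
    rwa [e, e', e'']

/-- One elementary step: a local complementation at a vertex, or the deletion of a vertex. -/
def Step {V : Type*} (G H : LabelledGraph V) : Prop :=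
  ∃ v ∈ G.verts, H = G.localComplement v ∨ H = G.deleteVerts {v}

/-- `H` is a vertex-minor of `G`: it arises from `G` by a finite sequence of local
complementations and vertex deletions. -/
def IsVertexMinor {V : Type*} (H G : LabelledGraph V) : Prop :=
  Relation.ReflTransGen Step G H

/-- The graph `K₂ ∪ K₂` with vertices `a₁, a₂, b₁, b₂` and edges `{a₁, a₂}`, `{b₁, b₂}`. -/
def twoPairs {V : Type*} (a₁ a₂ b₁ b₂ : V) : LabelledGraph V where
  verts := {a₁, a₂, b₁, b₂}
  Adj x y := x ≠ y ∧ (s(x, y) = s(a₁, a₂) ∨ s(x, y) = s(b₁, b₂))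
  adj_sub := fun h => h.1
  edge_vert := by
    rintro x y ⟨-, h⟩
    simp only [Sym2.eq_iff] at h
    simp only [Set.mem_insert_iff, Set.mem_singleton_iff]
    tauto
  symm := by
    constructor
    intro x y h
    rw [Sym2.eq_swap]
    exact ⟨h.1.symm, h.2⟩

/-- A simple graph on all of `V`, as a labelled graph. -/
def ofSimpleGraph {V : Type*} (G : SimpleGraph V) : LabelledGraph V :=
  SimpleGraph.toSubgraph G le_top

end LabelledGraph

/-! ### Qubit registers, graph states, local Clifford operations and Pauli measurements -/

/-- A (not necessarily normalised) vector of a register of qubits indexed by `V`, given by its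
amplitudes in the computational basis. -/
abbrev QState (V : Type*) := (V → Fin 2) → ℂ

/-- The graph state: apply, for every edge `e` of `G`, the controlled-`Z` gate (the diagonal gate
with entry `-1` exactly where both ends of `e` are in state `1`) to the product of the states
`(|0⟩ + |1⟩)/√2`. -/
noncomputable def graphState {V : Type*} [Fintype V] [DecidableEq V] (G : SimpleGraph V)
    [DecidableRel G.Adj] : QState V :=
  fun x => (∏ e ∈ G.edgeFinset, if ∀ v ∈ e, x v = 1 then (-1 : ℂ) else 1) *
    ∏ _v : V, ((1 / Real.sqrt 2 : ℝ) : ℂ)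

/-- The one-qubit operator `A`, applied to the qubit `v`. -/
noncomputable def applyAt {V : Type*} [DecidableEq V] (v : V) (A : Matrix (Fin 2) (Fin 2) ℂ)
    (ψ : QState V) : QState V :=
  fun x => ∑ b : Fin 2, A (x v) b * ψ (Function.update x v b)

/-- The three measurement bases. -/
inductive PauliAxis where
  | X
  | Y
  | Z

/-- The Pauli matrices. -/
noncomputable def PauliAxis.matrix : PauliAxis → Matrix (Fin 2) (Fin 2) ℂ
  | .X => !![0, 1; 1, 0]
  | .Y => !![0, -Complex.I; Complex.I, 0]
  | .Z => !![1, 0; 0, -1]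

/-- The one-qubit Pauli group: the matrices `iᵏ • P` with `P` the identity or a Pauli matrix. -/
def IsPauliElement (A : Matrix (Fin 2) (Fin 2) ℂ) : Prop :=
  ∃ k : ℕ, A = Complex.I ^ k • (1 : Matrix (Fin 2) (Fin 2) ℂ) ∨
    ∃ P : PauliAxis, A = Complex.I ^ k • P.matrix

/-- The one-qubit Clifford group: the unitaries that map the Pauli group to itself under
conjugation. -/
def IsClifford (U : Matrix (Fin 2) (Fin 2) ℂ) : Prop :=
  U ∈ Matrix.unitaryGroup (Fin 2) ℂ ∧ ∀ A, IsPauliElement A → IsPauliElement (U * A * Uᴴ)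

/-- The projector onto the eigenspace of the Pauli matrix `P` with eigenvalue `(-1)ˢ`. -/
noncomputable def pauliProjector (P : PauliAxis) (s : Fin 2) : Matrix (Fin 2) (Fin 2) ℂ :=
  (1 / 2 : ℂ) • (1 + (-1 : ℂ) ^ (s : ℕ) • P.matrix)

/-- A protocol of local Clifford operations, local Pauli measurements and classical communication:
a finite decision tree in which everything that follows a measurement may depend on its outcome,
at whichever qubits the later operations act. -/
inductive LocalProtocol (V : Type*) where
  | done : LocalProtocol V
  | clifford (v : V) (U : Matrix (Fin 2) (Fin 2) ℂ) (hU : IsClifford U)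
      (next : LocalProtocol V) : LocalProtocol V
  | measure (v : V) (P : PauliAxis) (next : Fin 2 → LocalProtocol V) : LocalProtocol V

/-- The final unnormalised vectors of the branches of a protocol started in `ψ`, one for each
record of measurement outcomes. If `ψ` has norm one, then the squared norm of such a vector is the
probability of its record; in particular a record has nonzero probability exactly if its vector
is nonzero. -/
def LocalProtocol.branches {V : Type*} [DecidableEq V] :
    LocalProtocol V → QState V → Set (QState V)
  | .done, ψ => {ψ}
  | .clifford v U _ next, ψ => next.branches (applyAt v U ψ)
  | .measure v P next, ψ =>
      {φ | ∃ s : Fin 2, φ ∈ (next s).branches (applyAt v (pauliProjector P s) ψ)}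

/-- The two-qubit vector `∑ M i j |i j⟩` is normalised and maximally entangled: its reduced
density matrix `M * Mᴴ` is maximally mixed. -/
def IsMaximallyEntangled (M : Matrix (Fin 2) (Fin 2) ℂ) : Prop :=
  M * Mᴴ = (1 / 2 : ℂ) • (1 : Matrix (Fin 2) (Fin 2) ℂ)

/-- The vector `φ` is nonzero and is a tensor product of a maximally entangled state of the qubits
`a₁, a₂`, a maximally entangled state of the qubits `b₁, b₂` and a vector of all other qubits. -/
def HasTwoPairs {V : Type*} (φ : QState V) (a₁ a₂ b₁ b₂ : V) : Prop :=
  ∃ M N : Matrix (Fin 2) (Fin 2) ℂ, ∃ χ : QState {v : V // v ∉ ({a₁, a₂, b₁, b₂} : Set V)},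
    IsMaximallyEntangled M ∧ IsMaximallyEntangled N ∧ χ ≠ 0 ∧
      ∀ x : V → Fin 2, φ x = M (x a₁) (x a₂) * N (x b₁) (x b₂) * χ (fun v => x v)

/-- Some protocol of local Clifford operations, local Pauli measurements and classical
communication, started in `ψ`, produces with nonzero probability maximally entangled pairs on
`{a₁, a₂}` and on `{b₁, b₂}`. -/
def CanExtractTwoPairs {V : Type*} [DecidableEq V] (ψ : QState V) (a₁ a₂ b₁ b₂ : V) : Prop :=
  ∃ p : LocalProtocol V, ∃ φ ∈ p.branches ψ, HasTwoPairs φ a₁ a₂ b₁ b₂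

/-! Deleting `b₁` and `b₂` cuts the ring into two arcs; let `S` be the one containing `a₂`. Both
parts hold for any graph in which `b₁`, `b₂` separate `S` from `a₁`. (i) The graph state is `f * g`,
with `f` independent of the qubits in `S` and `g` depending only on those in `S ∪ {b₁, b₂}`. Any
one-qubit operator keeps this form up to operators `A`, `B` on `b₁`, `b₂` (`IsSplit.applyAt`). If
two pairs resulted, full rank of the `b`-pair would make `A` and `B` invertible; undoing them and
fixing all qubits but `a₁`, `a₂` would give the `a`-pair rank one (`not_hasTwoPairs_of_isSplit`).
(ii) A vector `c` over the two-element field encodes a stabilizer element with X-part `c` and Z-part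
`neighborSum c`. Pairs of such elements lift backwards along vertex-minor steps with the same
commutator at each vertex (`IsVertexMinor.liftsStabilizers`). The generators at `a₁` and `a₂` of the
two-pair graph would lift to elements with no X-part at `b₁`, `b₂`, so their commutators on `S` sum
to zero (`sum_localForm_eq_zero`), although `a₂` alone contributes, with value 1. -/

/-! ### One-qubit operators -/

section ApplyAt

variable {V : Type*} [DecidableEq V]

theorem applyAt_applyAt_same (v : V) (A B : Matrix (Fin 2) (Fin 2) ℂ) (ψ : QState V) :
    applyAt v A (applyAt v B ψ) = applyAt v (A * B) ψ := by
  funext x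
  simp only [applyAt, Fin.sum_univ_two, Matrix.mul_apply, Function.update_self,
    Function.update_idem]
  ring

theorem applyAt_comm {v w : V} (h : v ≠ w) (A B : Matrix (Fin 2) (Fin 2) ℂ) (ψ : QState V) :
    applyAt v A (applyAt w B ψ) = applyAt w B (applyAt v A ψ) := by
  funext x
  simp only [applyAt, Fin.sum_univ_two, Function.update_of_ne h, Function.update_of_ne h.symm]
  simp only [fun c d => Function.update_comm h c d x]
  ring

theorem applyAt_one (v : V) (ψ : QState V) : applyAt v 1 ψ = ψ := by
  funext x
  simp [applyAt, Matrix.one_apply]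

theorem applyAt_zero (v : V) (ψ : QState V) : applyAt v 0 ψ = 0 := by
  funext x
  simp [applyAt]

theorem DependsOn.update_eq {f : QState V} {s : Set V} (hf : DependsOn f s) {v : V} (hv : v ∉ s)
    (x : V → Fin 2) (b : Fin 2) : f (Function.update x v b) = f x :=
  hf fun i hi => Function.update_of_ne (fun h : i = v => hv (h ▸ hi)) _ _

theorem applyAt_mul_left {v : V} {f : QState V} {s : Set V} (hf : DependsOn f s) (hv : v ∉ s)
    (A : Matrix (Fin 2) (Fin 2) ℂ) (g : QState V) :
    applyAt v A (f * g) = f * applyAt v A g := by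
  funext x
  simp only [applyAt, Pi.mul_apply, hf.update_eq hv, Finset.mul_sum]
  exact Finset.sum_congr rfl fun _ _ => by ring

theorem DependsOn.applyAt {f : QState V} {s : Set V} (hf : DependsOn f s) {v : V} (hv : v ∈ s)
    (A : Matrix (Fin 2) (Fin 2) ℂ) : DependsOn (applyAt v A f) s := by
  intro x y h
  simp only [_root_.applyAt, h v hv]
  refine Finset.sum_congr rfl fun b _ => ?_
  congr 1
  refine hf fun i hi => ?_
  by_cases hiv : i = v
  · subst hiv; simp
  · simp [hiv, h i hi]

end ApplyAt

/-! ### States split by two qubits -/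

/-- Up to operators acting on the qubits `b₁` and `b₂`, the vector `ψ` is a product of a function
of the qubits outside `S` and a function of the qubits in `S` and `b₁`, `b₂`. -/
def IsSplit {V : Type*} [DecidableEq V] (S : Set V) (b₁ b₂ : V) (ψ : QState V) : Prop :=
  ∃ (A B : Matrix (Fin 2) (Fin 2) ℂ) (f g : QState V),
    DependsOn f Sᶜ ∧ DependsOn g (S ∪ {b₁, b₂}) ∧ ψ = applyAt b₁ A (applyAt b₂ B (f * g))

section Split

variable {V : Type*} [DecidableEq V] {S : Set V} {a₁ a₂ b₁ b₂ : V}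

/-- An operator on `b₁` or `b₂` is absorbed into `A` or `B`; any other commutes past these and acts
on only one of `f`, `g`. As `U` is arbitrary, Clifford gates and projectors are covered together. -/
theorem IsSplit.applyAt (hb : b₁ ≠ b₂) {ψ : QState V} (h : IsSplit S b₁ b₂ ψ) (v : V)
    (U : Matrix (Fin 2) (Fin 2) ℂ) : IsSplit S b₁ b₂ (applyAt v U ψ) := by
  obtain ⟨A, B, f, g, hf, hg, rfl⟩ := h
  by_cases h₁ : v = b₁
  · subst h₁
    exact ⟨U * A, B, f, g, hf, hg, applyAt_applyAt_same _ _ _ _⟩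
  by_cases h₂ : v = b₂
  · subst h₂
    exact ⟨A, U * B, f, g, hf, hg, by rw [applyAt_comm h₁, applyAt_applyAt_same]⟩
  by_cases hv : v ∈ S
  · refine ⟨A, B, f, _root_.applyAt v U g, hf, hg.applyAt (Or.inl hv) U, ?_⟩
    rw [applyAt_comm h₁, applyAt_comm h₂, applyAt_mul_left hf (by simpa using hv)]
  · refine ⟨A, B, _root_.applyAt v U f, g, hf.applyAt hv U, hg, ?_⟩
    rw [applyAt_comm h₁, applyAt_comm h₂, mul_comm f,
      applyAt_mul_left hg (by simp [hv, h₁, h₂]), mul_comm]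

theorem IsSplit.of_mem_branches (hb : b₁ ≠ b₂) (p : LocalProtocol V) {ψ φ : QState V}
    (h : IsSplit S b₁ b₂ ψ) (hφ : φ ∈ p.branches ψ) : IsSplit S b₁ b₂ φ := by
  induction p generalizing ψ with
  | done =>
    rw [LocalProtocol.branches, Set.mem_singleton_iff] at hφ
    exact hφ ▸ h
  | clifford v U _ next ih => exact ih (h.applyAt hb v U) hφ
  | measure v P next ih =>
    obtain ⟨s, hs⟩ := hφ
    exact ih s (h.applyAt hb v _) hs

theorem isSplit_graphState [Fintype V] (G : SimpleGraph V) [DecidableRel G.Adj]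
    (hS : ∀ u v, u ∈ S → G.Adj u v → v ∈ S ∨ v = b₁ ∨ v = b₂) :
    IsSplit S b₁ b₂ (graphState G) := by
  classical
  let w (e : Sym2 V) (x : V → Fin 2) : ℂ := if ∀ v ∈ e, x v = 1 then -1 else 1
  have hw (e : Sym2 V) : DependsOn (w e) {v | v ∈ e} := by
    intro x y h
    have : (∀ v ∈ e, x v = 1) ↔ ∀ v ∈ e, y v = 1 :=
      forall₂_congr fun v hv => by rw [h v hv]
    simp only [w, this]
  -- An edge meeting `S` has both ends in `S ∪ {b₁, b₂}`, so its phase goes to `g`; the other phases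
  -- and the normalisation go to `f`.
  refine ⟨1, 1,
    fun x => (∏ e ∈ G.edgeFinset with ¬ ∃ u ∈ e, u ∈ S, w e x) *
      ∏ _v : V, ((1 / Real.sqrt 2 : ℝ) : ℂ),
    fun x => ∏ e ∈ G.edgeFinset with ∃ u ∈ e, u ∈ S, w e x, ?_, ?_, ?_⟩
  · intro x y h
    dsimp only
    congr 1
    refine Finset.prod_congr rfl fun e he => hw e fun v hv => h v fun hvS => ?_
    exact (Finset.mem_filter.mp he).2 ⟨v, hv, hvS⟩
  · intro x y h
    refine Finset.prod_congr rfl fun e he => hw e fun v hv => h v ?_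
    obtain ⟨he, u, hu, huS⟩ := Finset.mem_filter.mp he
    by_cases huv : u = v
    · exact Or.inl (huv ▸ huS)
    · rw [(Sym2.mem_and_mem_iff huv).mp ⟨hu, hv⟩, SimpleGraph.mem_edgeFinset,
        SimpleGraph.mem_edgeSet] at he
      rcases hS u v huS he with h | h | h
      exacts [Or.inl h, Or.inr (Or.inl h), Or.inr (Or.inr h)]
  · rw [applyAt_one, applyAt_one]
    funext x
    simp only [Pi.mul_apply, graphState]
    rw [← Finset.prod_filter_mul_prod_filter_not G.edgeFinset (fun e => ∃ u ∈ e, u ∈ S)]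
    ring

end Split

/-! ### Two maximally entangled pairs -/

/-- The vector `|M⟩ ⊗ |N⟩ ⊗ |χ⟩` with `M` on the qubits `a₁, a₂` and `N` on `b₁, b₂`. -/
def pairProduct {V : Type*} (a₁ a₂ b₁ b₂ : V) (M N : Matrix (Fin 2) (Fin 2) ℂ)
    (χ : QState {v : V // v ∉ ({a₁, a₂, b₁, b₂} : Set V)}) : QState V :=
  fun x => M (x a₁) (x a₂) * N (x b₁) (x b₂) * χ (fun v => x v)

theorem IsMaximallyEntangled.isUnit_det {M : Matrix (Fin 2) (Fin 2) ℂ}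
    (hM : IsMaximallyEntangled M) : IsUnit M.det := by
  rw [isUnit_iff_ne_zero]
  intro h
  have := congrArg Matrix.det hM
  norm_num [Matrix.det_mul, h] at this

section PairProduct

variable {V : Type*} [DecidableEq V] {a₁ a₂ b₁ b₂ : V}
  {χ : QState {v : V // v ∉ ({a₁, a₂, b₁, b₂} : Set V)}}

theorem restrict_update {T : Set V} {v : V} (hv : v ∈ T) (x : V → Fin 2) (b : Fin 2) :
    (fun u : {u // u ∉ T} => Function.update x v b u) = fun u : {u // u ∉ T} => x u :=
  funext fun u => Function.update_of_ne (fun h : (u : V) = v => u.2 (h ▸ hv)) _ _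

theorem applyAt_pairProduct_left (h₁ : a₁ ≠ b₁) (h₂ : a₂ ≠ b₁) (hb : b₁ ≠ b₂)
    (M N C : Matrix (Fin 2) (Fin 2) ℂ) :
    applyAt b₁ C (pairProduct a₁ a₂ b₁ b₂ M N χ) = pairProduct a₁ a₂ b₁ b₂ M (C * N) χ := by
  funext x
  simp only [applyAt, pairProduct, Function.update_self, Function.update_of_ne h₁,
    Function.update_of_ne h₂, Function.update_of_ne hb.symm, Matrix.mul_apply,
    restrict_update (show b₁ ∈ ({a₁, a₂, b₁, b₂} : Set V) by simp), Finset.sum_mul,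
    Finset.mul_sum]
  exact Finset.sum_congr rfl fun _ _ => by ring

theorem applyAt_pairProduct_right (h₁ : a₁ ≠ b₂) (h₂ : a₂ ≠ b₂) (hb : b₁ ≠ b₂)
    (M N C : Matrix (Fin 2) (Fin 2) ℂ) :
    applyAt b₂ C (pairProduct a₁ a₂ b₁ b₂ M N χ) = pairProduct a₁ a₂ b₁ b₂ M (N * Cᵀ) χ := by
  funext x
  simp only [applyAt, pairProduct, Function.update_self, Function.update_of_ne h₁,
    Function.update_of_ne h₂, Function.update_of_ne hb, Matrix.mul_apply, Matrix.transpose_apply,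
    restrict_update (show b₂ ∈ ({a₁, a₂, b₁, b₂} : Set V) by simp), Finset.sum_mul,
    Finset.mul_sum]
  exact Finset.sum_congr rfl fun _ _ => by ring

/-- Some assignment with prescribed values at `a₁` and `a₂` is a witness that `N` and `χ` do not
vanish. -/
theorem exists_assignment (ha : a₁ ≠ a₂) (h₁₁ : a₁ ≠ b₁) (h₁₂ : a₁ ≠ b₂) (h₂₁ : a₂ ≠ b₁)
    (h₂₂ : a₂ ≠ b₂) (hb : b₁ ≠ b₂) {N : Matrix (Fin 2) (Fin 2) ℂ} (hN : N ≠ 0) (hχ : χ ≠ 0) :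
    ∃ (x : V → Fin 2) (c : ℂ), c ≠ 0 ∧ ∀ M s t,
      pairProduct a₁ a₂ b₁ b₂ M N χ (Function.update (Function.update x a₁ s) a₂ t) =
        M s t * c := by
  obtain ⟨y, hy⟩ := Function.ne_iff.mp hχ
  obtain ⟨i, hi⟩ := Function.ne_iff.mp hN
  obtain ⟨j, hij⟩ := Function.ne_iff.mp hi
  let x : V → Fin 2 := fun v =>
    if h : v ∉ ({a₁, a₂, b₁, b₂} : Set V) then y ⟨v, h⟩ else if v = b₁ then i else j
  have hx : (fun v : {v // v ∉ ({a₁, a₂, b₁, b₂} : Set V)} => x v) = y :=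
    funext fun v => dif_pos v.2
  have hx₁ : x b₁ = i := by simp [x]
  have hx₂ : x b₂ = j := by simp [x, hb.symm]
  refine ⟨x, N i j * χ y, mul_ne_zero hij hy, fun M s t => ?_⟩
  rw [pairProduct, restrict_update (by simp), restrict_update (by simp), hx]
  simp only [Function.update_self, Function.update_of_ne ha, Function.update_of_ne h₁₁.symm,
    Function.update_of_ne h₁₂.symm, Function.update_of_ne h₂₁.symm,
    Function.update_of_ne h₂₂.symm, hx₁, hx₂]
  ring

theorem pairProduct_ne_zero (ha : a₁ ≠ a₂) (h₁₁ : a₁ ≠ b₁) (h₁₂ : a₁ ≠ b₂) (h₂₁ : a₂ ≠ b₁)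
    (h₂₂ : a₂ ≠ b₂) (hb : b₁ ≠ b₂) {M N : Matrix (Fin 2) (Fin 2) ℂ} (hM : M ≠ 0) (hN : N ≠ 0)
    (hχ : χ ≠ 0) : pairProduct a₁ a₂ b₁ b₂ M N χ ≠ 0 := by
  obtain ⟨x, c, hc, hx⟩ := exists_assignment ha h₁₁ h₁₂ h₂₁ h₂₂ hb hN hχ
  obtain ⟨i, hi⟩ := Function.ne_iff.mp hM
  obtain ⟨j, hij⟩ := Function.ne_iff.mp hi
  intro h
  have := hx M i j
  rw [h] at this
  exact mul_ne_zero hij hc this.symm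

/-- A nonzero row vector annihilated by `A`, as a matrix. -/
theorem exists_ne_zero_mul_eq_zero {A : Matrix (Fin 2) (Fin 2) ℂ} (hA : ¬ IsUnit A.det) :
    ∃ C : Matrix (Fin 2) (Fin 2) ℂ, C ≠ 0 ∧ C * A = 0 := by
  rw [isUnit_iff_ne_zero, not_not] at hA
  obtain ⟨u, hu, huA⟩ := Matrix.exists_vecMul_eq_zero_iff.mpr hA
  refine ⟨Matrix.of fun _ => u, fun h => hu (congrFun h 0), ?_⟩
  ext i j
  exact congrFun huA j

theorem not_hasTwoPairs_of_isSplit {S : Set V} (ha₁ : a₁ ∉ S) (ha₂ : a₂ ∈ S) (h₁₁ : a₁ ≠ b₁)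
    (h₁₂ : a₁ ≠ b₂) (h₂₁ : a₂ ≠ b₁) (h₂₂ : a₂ ≠ b₂) (hb : b₁ ≠ b₂) {φ : QState V}
    (h : IsSplit S b₁ b₂ φ) : ¬ HasTwoPairs φ a₁ a₂ b₁ b₂ := by
  rintro ⟨M, N, χ, hM, hN, hχ, hφ⟩
  have ha : a₁ ≠ a₂ := fun h => ha₁ (h ▸ ha₂)
  have hMu := hM.isUnit_det
  have hNu := hN.isUnit_det
  have ne_zero {P : Matrix (Fin 2) (Fin 2) ℂ} (hP : IsUnit P.det) : P ≠ 0 := by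
    rintro rfl
    simp at hP
  obtain ⟨A, B, f, g, hf, hg, hsplit⟩ := h
  obtain rfl : φ = pairProduct a₁ a₂ b₁ b₂ M N χ := funext hφ
  -- If `A` were singular, some nonzero `C` on `b₁` would kill the state; but it turns `N` into `C *
  -- N`, which is nonzero because `N` is invertible.
  have hA : IsUnit A.det := by
    by_contra hA
    obtain ⟨C, hC, hCA⟩ := exists_ne_zero_mul_eq_zero hA
    have h0 := congrArg (applyAt b₁ C) hsplit
    rw [applyAt_pairProduct_left h₁₁ h₂₁ hb, applyAt_applyAt_same, hCA, applyAt_zero] at h0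
    refine pairProduct_ne_zero ha h₁₁ h₁₂ h₂₁ h₂₂ hb (ne_zero hMu) (fun hz => hC ?_) hχ h0
    rw [← Matrix.mul_nonsing_inv_cancel_right (A := N) C hNu, hz, zero_mul]
  have hB : IsUnit B.det := by
    by_contra hB
    obtain ⟨C, hC, hCB⟩ := exists_ne_zero_mul_eq_zero hB
    have h0 := congrArg (applyAt b₂ C) hsplit
    -- The zero vector is written as the zero matrix applied at `b₁`, so that `A` can be multiplied
    -- into it.
    rw [applyAt_pairProduct_right h₁₂ h₂₂ hb, applyAt_comm hb.symm, applyAt_applyAt_same, hCB,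
      applyAt_zero, ← applyAt_zero b₁ (f * g), applyAt_applyAt_same, mul_zero,
      applyAt_zero] at h0
    refine pairProduct_ne_zero ha h₁₁ h₁₂ h₂₁ h₂₂ hb (ne_zero hMu) (fun hz => hC ?_) hχ h0
    rw [← Matrix.transpose_eq_zero, ← Matrix.nonsing_inv_mul_cancel_left (A := N) Cᵀ hNu, hz,
      mul_zero]
  have hfg : f * g = pairProduct a₁ a₂ b₁ b₂ M (A⁻¹ * N * B⁻¹ᵀ) χ := by
    rw [← applyAt_pairProduct_right h₁₂ h₂₂ hb, ← applyAt_pairProduct_left h₁₁ h₂₁ hb, hsplit,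
      applyAt_applyAt_same, Matrix.nonsing_inv_mul _ hA, applyAt_one, applyAt_applyAt_same,
      Matrix.nonsing_inv_mul _ hB, applyAt_one]
  have hN' : IsUnit (A⁻¹ * N * B⁻¹ᵀ).det := by
    rw [Matrix.det_mul, Matrix.det_mul, Matrix.det_transpose]
    exact ((Matrix.isUnit_nonsing_inv_det _ hA).mul hNu).mul (Matrix.isUnit_nonsing_inv_det _ hB)
  obtain ⟨x, c, hc, hx⟩ := exists_assignment ha h₁₁ h₁₂ h₂₁ h₂₂ hb (ne_zero hN') hχ
  -- `f` ignores the value at `a₂` and `g` the value at `a₁`, so `M` is an outer product up to the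
  -- factor `c`, and its determinant vanishes.
  have key (s t : Fin 2) :
      M s t * c = f (Function.update x a₁ s) * g (Function.update x a₂ t) := by
    rw [← hx M s t, ← hfg, Pi.mul_apply, hf.update_eq (by simpa using ha₂),
      Function.update_comm ha, hg.update_eq (by simp [ha₁, h₁₁, h₁₂])]
  refine hMu.ne_zero (mul_right_cancel₀ (mul_ne_zero hc hc) ?_)
  rw [Matrix.det_fin_two]
  linear_combination (M 1 1 * c) * key 0 0 - (M 1 0 * c) * key 0 1
    + f (Function.update x a₁ 0) * g (Function.update x a₂ 0) * key 1 1
    - f (Function.update x a₁ 0) * g (Function.update x a₂ 1) * key 1 0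

/-- If `b₁` and `b₂` separate `a₁` from `a₂`, then no protocol yields the two pairs. -/
theorem not_canExtractTwoPairs [Fintype V] {S : Set V} (G : SimpleGraph V) [DecidableRel G.Adj]
    (hS : ∀ u v, u ∈ S → G.Adj u v → v ∈ S ∨ v = b₁ ∨ v = b₂) (ha₁ : a₁ ∉ S) (ha₂ : a₂ ∈ S)
    (h₁₁ : a₁ ≠ b₁) (h₁₂ : a₁ ≠ b₂) (h₂₁ : a₂ ≠ b₁) (h₂₂ : a₂ ≠ b₂) (hb : b₁ ≠ b₂) :
    ¬ CanExtractTwoPairs (graphState G) a₁ a₂ b₁ b₂ := by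
  rintro ⟨p, φ, hφ, h⟩
  exact not_hasTwoPairs_of_isSplit ha₁ ha₂ h₁₁ h₁₂ h₂₁ h₂₂ hb
    ((isSplit_graphState G hS).of_mem_branches hb p hφ) h

end PairProduct

/-! ### Stabilizer vectors of labelled graphs over the field with two elements -/

namespace LabelledGraph

theorem Step.verts_subset {G H : LabelledGraph V} (h : Step G H) : H.verts ⊆ G.verts := by
  obtain ⟨v, hv, rfl | rfl⟩ := h
  · exact subset_rfl
  · exact Set.sdiff_subset

/-- The labelled graph `G` without the vertex `v`. -/
abbrev deleteVertex {V : Type*} (G : LabelledGraph V) (v : V) : LabelledGraph V :=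
  G.deleteVerts {v}

variable {V : Type*} [Fintype V]

open Classical in
/-- The adjacency matrix of `G` over the field with two elements, applied to `c`. -/
noncomputable def neighborSum (G : LabelledGraph V) (c : V → ZMod 2) (v : V) : ZMod 2 :=
  ∑ u, if G.Adj v u then c u else 0

/-- The commutator at the vertex `v` of the stabilizer elements given by `c` and `c'`. -/
noncomputable def localForm (G : LabelledGraph V) (c c' : V → ZMod 2) (v : V) : ZMod 2 :=
  c v * G.neighborSum c' v + G.neighborSum c v * c' v

/-- The stabilizer element given by `c` acts trivially at `v`. -/
def TrivialAt (G : LabelledGraph V) (c : V → ZMod 2) (v : V) : Prop :=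
  c v = 0 ∧ G.neighborSum c v = 0

/-- Every pair of stabilizer elements of `H` comes from a pair of stabilizer elements of `G` with
the same commutators at all vertices and without new nontrivial actions on the vertices of `H`. -/
def LiftsStabilizers (G H : LabelledGraph V) : Prop :=
  ∀ c c' : V → ZMod 2, (∀ v ∉ H.verts, c v = 0) → (∀ v ∉ H.verts, c' v = 0) →
    ∃ d d' : V → ZMod 2, (∀ v ∉ G.verts, d v = 0) ∧ (∀ v ∉ G.verts, d' v = 0) ∧
      (∀ v, G.localForm d d' v = H.localForm c c' v) ∧
      (∀ v ∈ H.verts, H.TrivialAt c v → G.TrivialAt d v) ∧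
      ∀ v ∈ H.verts, H.TrivialAt c' v → G.TrivialAt d' v

theorem LiftsStabilizers.refl (G : LabelledGraph V) : G.LiftsStabilizers G :=
  fun c c' hc hc' => ⟨c, c', hc, hc', fun _ => rfl, fun _ _ h => h, fun _ _ h => h⟩

/-- The inclusion is needed because the second lift controls triviality only on `H.verts`. -/
theorem LiftsStabilizers.trans {G H K : LabelledGraph V} (h : G.LiftsStabilizers H)
    (h' : H.LiftsStabilizers K) (hv : K.verts ⊆ H.verts) : G.LiftsStabilizers K := by
  intro c c' hc hc'
  obtain ⟨d, d', hd, hd', hf, ht, ht'⟩ := h' c c' hc hc'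
  obtain ⟨e, e', he, he', hg, hu, hu'⟩ := h d d' hd hd'
  exact ⟨e, e', he, he', fun v => (hg v).trans (hf v),
    fun v hv' hc => hu v (hv hv') (ht v hv' hc), fun v hv' hc => hu' v (hv hv') (ht' v hv' hc)⟩

open Classical in
theorem neighborSum_add_single (G : LabelledGraph V) (c : V → ZMod 2) (v w : V) (a : ZMod 2) :
    G.neighborSum (c + (Pi.single v a : V → ZMod 2)) w =
      G.neighborSum c w + if G.Adj w v then a else 0 := by
  have : ∀ u, (if G.Adj w u then (c + (Pi.single v a : V → ZMod 2)) u else 0) =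
      (if G.Adj w u then c u else 0) + if u = v then (if G.Adj w v then a else 0) else 0 := by
    intro u
    by_cases huv : u = v
    · subst huv; by_cases h : G.Adj w u <;> simp [h]
    · simp [huv]
  simp only [neighborSum, this, Finset.sum_add_distrib, Finset.sum_ite_eq', Finset.mem_univ,
    if_true]

open Classical in
-- Local complementation adds to the adjacency matrix the outer product of row `v` with itself, off
-- the diagonal; the term `c w` removes the diagonal entry.
theorem neighborSum_localComplement (G : LabelledGraph V) (c : V → ZMod 2) (v w : V) :
    (G.localComplement v).neighborSum c w =
      G.neighborSum c w + if G.Adj w v then G.neighborSum c v + c w else 0 := by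
  have key : ∀ u, (if (G.localComplement v).Adj w u then c u else 0) =
      (if G.Adj w u then c u else 0) +
        if G.Adj w v then (if G.Adj v u then c u else 0) + (if u = w then c w else 0) else 0 := by
    intro u
    have e : G.Adj v w ↔ G.Adj w v := G.adj_comm v w
    have two : c u + c u = 0 := CharTwo.add_self_eq_zero _
    by_cases huw : u = w
    · subst huw
      by_cases h : G.Adj u v <;> simp [localComplement, Xor, e, h, two]
    · have huw' : w ≠ u := Ne.symm huw
      by_cases h : G.Adj w v <;> by_cases h' : G.Adj v u <;> by_cases h'' : G.Adj w u <;>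
        simp [localComplement, Xor, e, h, h', h'', huw, huw', two]
  simp only [neighborSum, key, Finset.sum_add_distrib]
  by_cases h : G.Adj w v <;> simp [h, Finset.sum_add_distrib]

theorem liftsStabilizers_localComplement (G : LabelledGraph V) {v : V} (hv : v ∈ G.verts) :
    G.LiftsStabilizers (G.localComplement v) := by
  classical
  -- This is the local Clifford realising the complementation: it adds the Z-part to the X-part at
  -- `v` and the X-part to the Z-part at each neighbour. Such shears preserve the local symplectic
  -- form.
  let d (c : V → ZMod 2) : V → ZMod 2 := c + Pi.single v (G.neighborSum c v)
  have hirr : ¬ G.Adj v v := G.loopless.irrefl v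
  have two (a : ZMod 2) : a + a = 0 := CharTwo.add_self_eq_zero _
  have at_self (c : V → ZMod 2) : d c v = c v + G.neighborSum c v ∧
      G.neighborSum (d c) v = G.neighborSum c v ∧
      (G.localComplement v).neighborSum c v = G.neighborSum c v := by
    simp [d, neighborSum_add_single, neighborSum_localComplement, hirr]
  have at_other (c : V → ZMod 2) {w : V} (hw : w ≠ v) : d c w = c w ∧
      (G.localComplement v).neighborSum c w =
        G.neighborSum (d c) w + if G.Adj w v then c w else 0 := by
    refine ⟨by simp [d, hw], ?_⟩
    by_cases h : G.Adj w v <;>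
      simp [d, neighborSum_add_single, neighborSum_localComplement, h, add_assoc]
  have supp (c : V → ZMod 2) (hc : ∀ w ∉ G.verts, c w = 0) : ∀ w ∉ G.verts, d c w = 0 := by
    intro w hw
    rw [(at_other c (fun h : w = v => hw (h ▸ hv))).1, hc w hw]
  have triv (c : V → ZMod 2) (w : V) (h : (G.localComplement v).TrivialAt c w) :
      G.TrivialAt (d c) w := by
    obtain ⟨h₁, h₂⟩ := h
    by_cases hw : w = v
    · subst hw
      obtain ⟨e₁, e₂, e₃⟩ := at_self c
      rw [e₃] at h₂
      exact ⟨by rw [e₁, h₁, h₂, add_zero], by rw [e₂, h₂]⟩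
    · obtain ⟨e₁, e₂⟩ := at_other c hw
      rw [e₂, h₁, ite_self, add_zero] at h₂
      exact ⟨e₁.trans h₁, h₂⟩
  intro c c' hc hc'
  refine ⟨d c, d c', supp c hc, supp c' hc', fun w => ?_, fun w _ => triv c w,
    fun w _ => triv c' w⟩
  unfold localForm
  by_cases hw : w = v
  · subst hw
    obtain ⟨e₁, e₂, e₃⟩ := at_self c
    obtain ⟨e₁', e₂', e₃'⟩ := at_self c'
    rw [e₁, e₂, e₃, e₁', e₂', e₃']
    linear_combination two (G.neighborSum c w * G.neighborSum c' w)
  · obtain ⟨e₁, e₂⟩ := at_other c hw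
    obtain ⟨e₁', e₂'⟩ := at_other c' hw
    rw [e₁, e₂, e₁', e₂']
    split_ifs
    · linear_combination -two (c w * c' w)
    · ring

/-- The same vectors serve as lifts. They may acquire a Z-part at `v`, but their X-parts vanish
there, so the commutator at `v` is still zero. -/
theorem liftsStabilizers_deleteVertex (G : LabelledGraph V) {v : V} :
    G.LiftsStabilizers (G.deleteVertex v) := by
  classical
  have hv : v ∉ (G.deleteVertex v).verts := by simp
  have sum_eq (c : V → ZMod 2) (hc : ∀ w ∉ (G.deleteVertex v).verts, c w = 0) {w : V}
      (hw : w ≠ v) : (G.deleteVertex v).neighborSum c w = G.neighborSum c w := by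
    refine Finset.sum_congr rfl fun u _ => ?_
    by_cases huv : u = v
    · subst huv; simp [hc u hv]
    · have : (G.deleteVertex v).Adj w u ↔ G.Adj w u := by
        rw [SimpleGraph.Subgraph.deleteVerts_adj]
        simp only [Set.mem_singleton_iff]
        exact ⟨fun h => h.2.2.2.2, fun h => ⟨G.edge_vert h, hw, G.edge_vert h.symm, huv, h⟩⟩
      simp only [this]
  have supp (c : V → ZMod 2) (hc : ∀ w ∉ (G.deleteVertex v).verts, c w = 0) :
      ∀ w ∉ G.verts, c w = 0 := fun w hw => hc w fun h => hw h.1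
  have triv (c : V → ZMod 2) (hc : ∀ w ∉ (G.deleteVertex v).verts, c w = 0) (w : V)
      (hw : w ∈ (G.deleteVertex v).verts) (h : (G.deleteVertex v).TrivialAt c w) :
      G.TrivialAt c w :=
    ⟨h.1, by rw [← sum_eq c hc (by rintro rfl; exact hv hw)]; exact h.2⟩
  intro c c' hc hc'
  refine ⟨c, c', supp c hc, supp c' hc', fun w => ?_, triv c hc, triv c' hc'⟩
  by_cases hw : w = v
  · subst hw
    simp [localForm, hc w hv, hc' w hv]
  · rw [localForm, localForm, sum_eq c hc hw, sum_eq c' hc' hw]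

theorem Step.liftsStabilizers {G H : LabelledGraph V} (h : Step G H) : G.LiftsStabilizers H := by
  obtain ⟨v, hv, rfl | rfl⟩ := h
  · exact G.liftsStabilizers_localComplement hv
  · exact G.liftsStabilizers_deleteVertex

theorem IsVertexMinor.liftsStabilizers {G H : LabelledGraph V} (h : IsVertexMinor H G) :
    G.LiftsStabilizers H := by
  induction h with
  | refl => exact .refl G
  | tail _ hs ih => exact ih.trans hs.liftsStabilizers hs.verts_subset

/-- If all edges leaving `S` end in vertices where `d` and `d'` vanish, then the stabilizer
elements of `d` and `d'` commute on `S`. -/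
theorem sum_localForm_eq_zero (G : LabelledGraph V) (S : Finset V) (d d' : V → ZMod 2)
    (hS : ∀ u v, u ∈ S → G.Adj u v → v ∉ S → d v = 0 ∧ d' v = 0) :
    ∑ v ∈ S, G.localForm d d' v = 0 := by
  classical
  have restrict (e : V → ZMod 2) (he : ∀ u v, u ∈ S → G.Adj u v → v ∉ S → e v = 0) (v : V)
      (hv : v ∈ S) : G.neighborSum e v = ∑ u ∈ S, if G.Adj v u then e u else 0 := by
    refine (Finset.sum_subset (Finset.subset_univ S) fun u _ hu => ?_).symm
    split_ifs with h
    · exact he v u hv h hu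
    · rfl
  have hd := restrict d fun u v hu h hv => (hS u v hu h hv).1
  have hd' := restrict d' fun u v hu h hv => (hS u v hu h hv).2
  -- By symmetry of adjacency both halves equal the same double sum over `S`, so they cancel in
  -- characteristic 2.
  have e₁ : ∑ v ∈ S, d v * G.neighborSum d' v =
      ∑ v ∈ S, ∑ u ∈ S, if G.Adj v u then d v * d' u else 0 :=
    Finset.sum_congr rfl fun v hv => by simp only [hd' v hv, Finset.mul_sum, mul_ite, mul_zero]
  have e₂ : ∑ v ∈ S, G.neighborSum d v * d' v =
      ∑ v ∈ S, ∑ u ∈ S, if G.Adj v u then d v * d' u else 0 := by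
    rw [Finset.sum_comm]
    refine Finset.sum_congr rfl fun v hv => ?_
    simp only [hd v hv, Finset.sum_mul, ite_mul, zero_mul, G.adj_comm v]
  simp only [localForm, Finset.sum_add_distrib]
  rw [e₁, e₂, CharTwo.add_self_eq_zero]

open Classical in
theorem neighborSum_single (G : LabelledGraph V) (u v : V) :
    G.neighborSum (Pi.single u 1) v = if G.Adj v u then 1 else 0 := by
  rw [neighborSum, Finset.sum_eq_single u (fun w _ hw => by simp [hw]) (by simp), Pi.single_eq_same]

/-- If `b₁` and `b₂` separate `a₁` from `a₂` in `G`, then the graph with the two edges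
`{a₁, a₂}` and `{b₁, b₂}` is not a vertex-minor of `G`. -/
theorem not_isVertexMinor_twoPairs {a₁ a₂ b₁ b₂ : V} {S : Finset V} (G : LabelledGraph V)
    (hS : ∀ u v, u ∈ S → G.Adj u v → v ∈ S ∨ v = b₁ ∨ v = b₂) (ha₁ : a₁ ∉ S) (ha₂ : a₂ ∈ S)
    (h₁₁ : a₁ ≠ b₁) (h₁₂ : a₁ ≠ b₂) (h₂₁ : a₂ ≠ b₁) (h₂₂ : a₂ ≠ b₂) :
    ¬ IsVertexMinor (twoPairs a₁ a₂ b₁ b₂) G := by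
  classical
  intro h
  have ha : a₁ ≠ a₂ := fun h : a₁ = a₂ => ha₁ (h ▸ ha₂)
  have single_eq {u v : V} (h : v ≠ u) : (Pi.single u 1 : V → ZMod 2) v = 0 := by simp [h]
  have hadj₁ (v : V) : (twoPairs a₁ a₂ b₁ b₂).Adj v a₁ ↔ v = a₂ := by
    simp only [twoPairs, Sym2.eq_iff]
    grind
  have hadj₂ (v : V) : (twoPairs a₁ a₂ b₁ b₂).Adj v a₂ ↔ v = a₁ := by
    simp only [twoPairs, Sym2.eq_iff]
    grind
  -- These are the stabilizer elements `X ⊗ Z` and `Z ⊗ X` of the pair `a₁, a₂`: they anticommute at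
  -- each of these two vertices and are trivial at `b₁`, `b₂`.
  obtain ⟨d, d', -, -, hform, ht, ht'⟩ := h.liftsStabilizers (Pi.single a₁ 1) (Pi.single a₂ 1)
    (fun v hv => single_eq fun h => hv (by simp [twoPairs, h]))
    (fun v hv => single_eq fun h => hv (by simp [twoPairs, h]))
  have triv {b : V} (hb : b = b₁ ∨ b = b₂) : d b = 0 ∧ d' b = 0 := by
    have hm : b ∈ (twoPairs a₁ a₂ b₁ b₂).verts := by
      rcases hb with rfl | rfl <;> simp [twoPairs]
    have n₁ : b ≠ a₁ := by rcases hb with rfl | rfl <;> exact Ne.symm ‹_›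
    have n₂ : b ≠ a₂ := by rcases hb with rfl | rfl <;> exact Ne.symm ‹_›
    exact ⟨(ht b hm ⟨single_eq n₁, by simp [neighborSum_single, hadj₁, n₂]⟩).1,
      (ht' b hm ⟨single_eq n₂, by simp [neighborSum_single, hadj₂, n₁]⟩).1⟩
  have hzero := G.sum_localForm_eq_zero S d d' fun u v hu huv hv =>
    triv ((hS u v hu huv).resolve_left hv)
  rw [Finset.sum_eq_single_of_mem a₂ ha₂, hform] at hzero
  · simp [localForm, neighborSum_single, hadj₁, hadj₂, ha.symm] at hzero
  · intro v hv hne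
    rw [hform, localForm, single_eq (fun h : v = a₁ => ha₁ (h ▸ hv)), single_eq hne]
    ring

end LabelledGraph

/-- The only vertices of the ring adjacent to an open arc are the arc itself and its two ends. -/
theorem cycleGraph_adj_of_mem_Ioo {n : ℕ} {b₁ b₂ u v : Fin n} (hu : u ∈ Finset.Ioo b₁ b₂)
    (h : (SimpleGraph.cycleGraph n).Adj u v) : v ∈ Finset.Ioo b₁ b₂ ∨ v = b₁ ∨ v = b₂ := by
  rw [SimpleGraph.cycleGraph_adj'] at h
  rw [Finset.mem_Ioo] at hu ⊢
  simp only [Fin.lt_def, Fin.ext_iff] at hu ⊢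
  simp only [Fin.sub_def] at h
  have := u.isLt
  have := v.isLt
  have := b₂.isLt
  rcases h with h | h
  -- Without reduction mod `n`, the value 1 means that the edge joins `n - 1` and `0`; `u` is
  -- neither, being strictly between `b₁` and `b₂`.
  · rcases lt_or_ge (n - (v : ℕ) + u) n with h' | h'
    · rw [Nat.mod_eq_of_lt h'] at h; omega
    · rw [Nat.mod_eq_sub_mod h', Nat.mod_eq_of_lt (by omega)] at h; omega
  · rcases lt_or_ge (n - (u : ℕ) + v) n with h' | h'
    · rw [Nat.mod_eq_of_lt h'] at h; omega
    · rw [Nat.mod_eq_sub_mod h', Nat.mod_eq_of_lt (by omega)] at h; omega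

/-- No crossing on a ring; the vertices `1, …, n` of the ring are the elements `0, …, n - 1` of
`Fin n`, so that the first vertex has value `0`. -/
theorem theorem1 (n : ℕ) (a₁ b₁ a₂ b₂ : Fin n) (ha₁ : (a₁ : ℕ) = 0)
    (h₁ : a₁ < b₁) (h₂ : b₁ < a₂) (h₃ : a₂ < b₂) :
    ¬ CanExtractTwoPairs (graphState (SimpleGraph.cycleGraph n)) a₁ a₂ b₁ b₂ ∧
    ¬ LabelledGraph.IsVertexMinor (LabelledGraph.twoPairs a₁ a₂ b₁ b₂)
        (LabelledGraph.ofSimpleGraph (SimpleGraph.cycleGraph n)) := by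
  have hb : b₁ < b₂ := h₂.trans h₃
  have hs₁ : a₁ ∉ Finset.Ioo b₁ b₂ := fun h => (h₁.trans (Finset.mem_Ioo.mp h).1).false
  have hs₂ : a₂ ∈ Finset.Ioo b₁ b₂ := Finset.mem_Ioo.mpr ⟨h₂, h₃⟩
  constructor
  · exact not_canExtractTwoPairs (S := ↑(Finset.Ioo b₁ b₂)) _
      (fun u v hu h => by exact_mod_cast cycleGraph_adj_of_mem_Ioo (by exact_mod_cast hu) h)
      (by exact_mod_cast hs₁) (by exact_mod_cast hs₂) h₁.ne (h₁.trans hb).ne h₂.ne' h₃.ne hb.ne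
  · exact LabelledGraph.not_isVertexMinor_twoPairs _
      (fun u v hu h => cycleGraph_adj_of_mem_Ioo hu h) hs₁ hs₂ h₁.ne (h₁.trans hb).ne h₂.ne' h₃.ne
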